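/- For a real number $p\ge 1$ let $\ell^p$ denote the equivalence relation on $\mathbb R^{\mathbb N}$ (with the product topology and its Borel structure) given by $$x\mathrel{\ell^p}y\iff\sum_{k\in\mathbb N}|x(k)-y(k)|^p<\infty .$$ For equivalence relations $E,F$ on standard Borel spaces $X,Y$, write $E\le_B F$ ($E$ is Borel reducible to $F$) if there is a Borel map $\vartheta:X\to Y$ such that $x\mathrel{E}y\iff\vartheta(x)\mathrel{F}\vartheta(y)$ for all $x,y\in X$, and write $E<_B F$ ($E$ is strictly Borel reducible to $F$) if $E\le_B F$ but not $F\le_B E$. **Theorem (Dougherty–Hjorth).** If $1\le p<q<\infty$, then $\ell^p<_B\ell^q$; that is, $\ell^p\le_B\ell^q$ and $\ell^q\not\le_B\ell^p$. -/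

import Mathlib

/-- The equivalence relation `ℓ^p` (`1 ≤ p < ∞`) on the space `ℕ → ℝ` of all real sequences:
`x ℓ^p y` iff `∑ k, |x k - y k| ^ p < ∞`. -/
def ellSetoid (p : ℝ) (hp : 1 ≤ p) : Setoid (ℕ → ℝ) where
  r x y := Summable fun k : ℕ => |x k - y k| ^ p
  iseqv := by
    have hp0 : 0 < p := lt_of_lt_of_le one_pos hp
    refine ⟨fun x => ?_, fun {x y} h => ?_, fun {x y z} h₁ h₂ => ?_⟩
    · simp [Real.zero_rpow hp0.ne', summable_zero]
    · simpa only [abs_sub_comm] using h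
    · have hs := (Real.summable_Lp_add_of_nonneg hp (f := fun k => |x k - y k|) (g := fun k => |y k - z k|)
        (fun _ => abs_nonneg _) (fun _ => abs_nonneg _) h₁ h₂)
      exact Summable.of_nonneg_of_le (fun _ => Real.rpow_nonneg (abs_nonneg _) _)
        (fun k => Real.rpow_le_rpow (abs_nonneg _) (abs_sub_le _ _ _) hp0.le) hs

/-- `E ≤_B F`, Borel reducibility of equivalence relations on standard Borel spaces
(that is, on Borel sets in Polish spaces): there is a Borel map `θ` with
`x E y ↔ θ x F θ y`. -/
def BorelReducible {X Y : Type*} [MeasurableSpace X] [StandardBorelSpace X]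
    [MeasurableSpace Y] [StandardBorelSpace Y] (E : Setoid X) (F : Setoid Y) : Prop :=
  ∃ θ : X → Y, Measurable θ ∧ ∀ x y : X, E x y ↔ F (θ x) (θ y)

/-- `E <_B F`, strict Borel reducibility: `E ≤_B F` but not `F ≤_B E`. -/
def StrictlyBorelReducible {X Y : Type*} [MeasurableSpace X] [StandardBorelSpace X]
    [MeasurableSpace Y] [StandardBorelSpace Y] (E : Setoid X) (F : Setoid Y) : Prop :=
  BorelReducible E F ∧ ¬ BorelReducible F E

/-! For the reduction, sines and cosines at all dyadic scales embed the line into `ℓ^q` so that the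
`q`-th power of the distance is comparable to `|x - y| ^ p` (`exists_snowflake_bounds`); this is
applied coordinate by coordinate.

Conversely, let `θ` reduce `ℓ^q` to `ℓ^p`. On dyadic grids, with values rounded to countably many,
Baire category makes `θ` additive: near a generic point and along a sparse set of coordinates, each
input coordinate governs its own block of output up to a summable error
(`exists_block_decomposition`). No additive reduction exists
(`not_forall_summable_iff_summable_block`): crossing `[0, 1]` in coordinate `j` must cost at least
some `c > 0` for large `j`, so among about `j ^ (1 / p)` equal steps one costs at least `c / (j +
1)`. These steps have divergent total cost, while the `q`-th powers of their lengths, about `j ^ (-q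
/ p)`, are summable. -/

/-! ### Reducibility: a snowflake embedding of the line -/

/-- The cosine for `true` and the sine for `false`. -/
noncomputable def trigFun (b : Bool) (x : ℝ) : ℝ := if b then Real.cos x else Real.sin x

theorem measurable_trigFun (b : Bool) : Measurable (trigFun b) := by
  cases b
  · exact Real.measurable_sin
  · exact Real.measurable_cos

theorem abs_trigFun_sub_le (b : Bool) (x y : ℝ) : |trigFun b x - trigFun b y| ≤ min 2 |x - y| := by
  refine le_min ?_ ?_
  · have h : ∀ z, |trigFun b z| ≤ 1 := fun z => by
      cases b
      · simpa [trigFun] using Real.abs_sin_le_one z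
      · simpa [trigFun] using Real.abs_cos_le_one z
    have := abs_sub (trigFun b x) (trigFun b y)
    linarith [h x, h y]
  · cases b
    · simpa [trigFun] using Real.abs_sin_sub_sin_le x y
    · simpa [trigFun] using Real.abs_cos_sub_cos_le x y

/-- The squared differences of the cosines and of the sines add up to `2 - 2 * cos (x - y)`, so one
of them is at least half of that. -/
theorem exists_le_abs_trigFun_sub {x y : ℝ} (h₁ : 1 / 2 ≤ |x - y|) (h₂ : |x - y| ≤ 1) :
    ∃ b, √(1 - Real.cos (1 / 2)) ≤ |trigFun b x - trigFun b y| := by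
  by_contra! h
  have hc := h true
  have hs := h false
  have hcos : Real.cos (x - y) ≤ Real.cos (1 / 2) := by
    rw [← Real.cos_abs (x - y)]
    exact Real.cos_le_cos_of_nonneg_of_le_pi (by norm_num) (by linarith [Real.pi_gt_three]) h₁
  rw [Real.cos_sub] at hcos
  have hnn : 0 ≤ 1 - Real.cos (1 / 2) := by linarith [Real.cos_le_one (1 / 2)]
  have sq1 := (sq_lt_sq₀ (abs_nonneg _) (Real.sqrt_nonneg _)).2 hc
  have sq2 := (sq_lt_sq₀ (abs_nonneg _) (Real.sqrt_nonneg _)).2 hs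
  rw [sq_abs, Real.sq_sqrt hnn] at sq1 sq2
  simp only [trigFun, if_true, Bool.false_eq_true, if_false] at sq1 sq2
  nlinarith [Real.sin_sq_add_cos_sq x, Real.sin_sq_add_cos_sq y]

/-- The terms decay like `2 ^ (-p * m)` as `m → ∞` and like `2 ^ ((q - p) * m)` as `m → -∞`; the
latter needs `p < q`. -/
theorem summable_int_two_rpow_mul_min {p q : ℝ} (hp : 0 < p) (hpq : p < q) :
    Summable fun m : ℤ => (2 : ℝ) ^ (-(p * m)) * (min 2 ((2 : ℝ) ^ m)) ^ q := by
  have hq : 0 < q := hp.trans hpq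
  have hgeom : ∀ r : ℝ, 0 < r → Summable fun n : ℕ => (2 : ℝ) ^ (-(r * n)) := fun r hr => by
    have : ∀ n : ℕ, (2 : ℝ) ^ (-(r * n)) = ((2 : ℝ) ^ (-r)) ^ n := fun n => by
      rw [← Real.rpow_natCast, ← Real.rpow_mul (by norm_num)]; ring_nf
    simp_rw [this]
    exact summable_geometric_of_lt_one (by positivity)
      (Real.rpow_lt_one_of_one_lt_of_neg (by norm_num) (by linarith))
  refine Summable.of_nat_of_neg ?_ ?_
  · refine Summable.of_nonneg_of_le (fun n => by positivity) (fun n => ?_)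
      ((hgeom p hp).mul_right ((2 : ℝ) ^ q))
    have : (min 2 ((2 : ℝ) ^ (n : ℤ))) ^ q ≤ 2 ^ q :=
      Real.rpow_le_rpow (by positivity) (min_le_left _ _) hq.le
    push_cast
    gcongr
  · refine Summable.of_nonneg_of_le (fun n => by positivity) (fun n => ?_)
      (hgeom (q - p) (by linarith))
    have : (min 2 ((2 : ℝ) ^ (-(n : ℤ)))) ^ q ≤ 2 ^ (-(q * n)) := by
      refine (Real.rpow_le_rpow (by positivity) (min_le_right _ _) hq.le).trans_eq ?_
      rw [← Real.rpow_intCast, ← Real.rpow_mul (by norm_num)]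
      push_cast; ring_nf
    refine (mul_le_mul_of_nonneg_left this (by positivity)).trans_eq ?_
    rw [← Real.rpow_add (by norm_num)]
    push_cast; ring_nf

/-- The coordinates of an embedding of the line into `ℓ^q` that turns `|x - y|` into a quantity
comparable with `|x - y| ^ (p / q)`. -/
noncomputable def snowflake (p q : ℝ) (x : ℝ) (i : ℤ × Bool) : ℝ :=
  (2 : ℝ) ^ (-(p / q * i.1)) * trigFun i.2 ((2 : ℝ) ^ i.1 * x)

theorem measurable_snowflake (p q : ℝ) (i : ℤ × Bool) : Measurable fun x => snowflake p q x i :=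
  ((measurable_trigFun i.2).comp (measurable_const_mul _)).const_mul _

theorem abs_snowflake_sub_rpow {p q : ℝ} (hq : 0 < q) (x y : ℝ) (i : ℤ × Bool) :
    |snowflake p q x i - snowflake p q y i| ^ q = (2 : ℝ) ^ (-(p * i.1)) *
      |trigFun i.2 ((2 : ℝ) ^ i.1 * x) - trigFun i.2 ((2 : ℝ) ^ i.1 * y)| ^ q := by
  rw [snowflake, snowflake, ← mul_sub, abs_mul, Real.mul_rpow (abs_nonneg _) (abs_nonneg _),
    abs_of_pos (by positivity), ← Real.rpow_mul (by norm_num)]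
  congr 2
  field_simp

theorem exists_snowflake_bounds {p q : ℝ} (hp : 0 < p) (hpq : p < q) :
    ∃ c C : ℝ, 0 < c ∧ ∀ x y : ℝ,
      (Summable fun i => |snowflake p q x i - snowflake p q y i| ^ q) ∧
      c * |x - y| ^ p ≤ ∑' i, |snowflake p q x i - snowflake p q y i| ^ q ∧
      ∑' i, |snowflake p q x i - snowflake p q y i| ^ q ≤ C * |x - y| ^ p := by
  have hq : 0 < q := hp.trans hpq
  set w : ℤ → ℝ := fun m => (2 : ℝ) ^ (-(p * m)) * (min 2 ((2 : ℝ) ^ m)) ^ q with hw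
  have hws : Summable fun i : ℤ × Bool => w i.1 := by
    refine (summable_prod_of_nonneg fun i => by simp only [hw, Pi.zero_apply]; positivity).2
      ⟨fun m => (hasSum_fintype _).summable, ?_⟩
    simpa using (summable_int_two_rpow_mul_min hp hpq).mul_left 2
  have hκ : 0 < √(1 - Real.cos (1 / 2)) := by
    rw [Real.sqrt_pos, sub_pos]
    have := Real.cos_lt_cos_of_nonneg_of_le_pi (x := 0) (y := 1 / 2) le_rfl
      (by linarith [Real.pi_gt_three]) (by norm_num)
    simpa using this
  refine ⟨√(1 - Real.cos (1 / 2)) ^ q, 2 ^ p * ∑' i : ℤ × Bool, w i.1, by positivity, fun x y => ?_⟩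
  rcases eq_or_ne x y with rfl | hxy
  · simp [Real.zero_rpow hp.ne', Real.zero_rpow hq.ne', summable_zero]
  have hd : 0 < |x - y| := abs_pos.2 (sub_ne_zero.2 hxy)
  set d := |x - y| with hd'
  -- At scale `N` the distance becomes comparable to 1. This one scale gives the lower bound;
  -- indexing the scales relative to `N` gives the upper bound.
  obtain ⟨N, hN₁, hN₂⟩ := exists_mem_Ico_zpow (inv_pos.2 hd) (one_lt_two (α := ℝ))
  have hsc : ∀ n : ℤ, |(2 : ℝ) ^ n * x - (2 : ℝ) ^ n * y| = 2 ^ n * d := fun n => by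
    rw [← mul_sub, abs_mul, abs_of_pos (by positivity)]
  have hNd : (2 : ℝ) ^ N * d ≤ 1 := by
    calc _ ≤ d⁻¹ * d := by gcongr
      _ = 1 := inv_mul_cancel₀ hd.ne'
  have hNd' : 1 / 2 ≤ (2 : ℝ) ^ N * d := by
    have : d⁻¹ * d < 2 ^ (N + 1) * d := by gcongr
    rw [inv_mul_cancel₀ hd.ne', zpow_add_one₀ (by norm_num)] at this
    linarith
  have hpow : ∀ n : ℤ, (2 : ℝ) ^ (-(p * n)) = (((2 : ℝ) ^ n)⁻¹) ^ p := fun n => by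
    rw [Real.inv_rpow (by positivity), ← Real.rpow_intCast, ← Real.rpow_mul (by norm_num),
      ← Real.rpow_neg (by norm_num), mul_comm]
  have hle : ∀ i : ℤ × Bool, |snowflake p q x (N + i.1, i.2) - snowflake p q y (N + i.1, i.2)| ^ q ≤
      2 ^ p * d ^ p * w i.1 := fun i => by
    rw [abs_snowflake_sub_rpow hq]
    have h1 : (2 : ℝ) ^ (-(p * (N : ℝ))) ≤ 2 ^ p * d ^ p := by
      rw [hpow, ← Real.mul_rpow (by norm_num) hd.le]
      refine Real.rpow_le_rpow (by positivity) ?_ hp.le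
      rw [inv_le_iff_one_le_mul₀ (by positivity)]
      linarith
    have h2 : |trigFun i.2 ((2 : ℝ) ^ (N + i.1) * x) - trigFun i.2 ((2 : ℝ) ^ (N + i.1) * y)| ≤
        min 2 ((2 : ℝ) ^ i.1) := by
      refine (abs_trigFun_sub_le _ _ _).trans (min_le_min le_rfl ?_)
      rw [hsc, zpow_add₀ (by norm_num)]
      have : 0 < (2 : ℝ) ^ i.1 := by positivity
      nlinarith
    have h3 := Real.rpow_le_rpow (abs_nonneg _) h2 hq.le
    have h4 : (2 : ℝ) ^ (-(p * ((N + i.1 : ℤ) : ℝ))) =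
        2 ^ (-(p * (N : ℝ))) * 2 ^ (-(p * (i.1 : ℝ))) := by
      rw [← Real.rpow_add (by norm_num)]; push_cast; ring_nf
    rw [h4, hw, mul_assoc]
    exact mul_le_mul h1 (mul_le_mul_of_nonneg_left h3 (by positivity)) (by positivity)
      (by positivity)
  set e : ℤ × Bool ≃ ℤ × Bool := (Equiv.addLeft N).prodCongr (Equiv.refl Bool)
  set F : ℤ × Bool → ℝ := fun i => |snowflake p q x i - snowflake p q y i| ^ q with hF
  have hF0 : ∀ i, 0 ≤ F i := fun i => by positivity
  have hs' : Summable (F ∘ e) :=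
    Summable.of_nonneg_of_le (fun i => hF0 _) hle (hws.mul_left _)
  have hs : Summable F := e.summable_iff.1 hs'
  refine ⟨hs, ?_, ?_⟩
  · obtain ⟨b, hb⟩ := exists_le_abs_trigFun_sub (x := (2 : ℝ) ^ N * x) (y := (2 : ℝ) ^ N * y)
      (by rw [hsc]; exact hNd') (by rw [hsc]; exact hNd)
    refine le_trans ?_ (hs.le_tsum (N, b) fun i _ => hF0 i)
    rw [hF]
    simp only
    rw [abs_snowflake_sub_rpow hq, mul_comm, hpow]
    refine mul_le_mul (Real.rpow_le_rpow hd.le ?_ hp.le) (Real.rpow_le_rpow hκ.le hb hq.le)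
      (by positivity) (by positivity)
    rw [le_inv_comm₀ hd (by positivity)]
    exact hN₁
  · rw [← e.tsum_eq F]
    refine (hs'.tsum_le_tsum hle (hws.mul_left _)).trans_eq ?_
    rw [tsum_mul_left]; ring

theorem borelReducible_ellSetoid {p q : ℝ} (hp : 1 ≤ p) (hpq : p < q) :
    BorelReducible (ellSetoid p hp) (ellSetoid q (hp.trans hpq.le)) := by
  have hp0 : 0 < p := one_pos.trans_le hp
  obtain ⟨c, C, hc, h⟩ := exists_snowflake_bounds hp0 hpq
  obtain ⟨e⟩ : Nonempty (ℕ ≃ ℕ × ℤ × Bool) := nonempty_equiv_of_countable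
  refine ⟨fun x k => snowflake p q (x (e k).1) (e k).2, ?_, fun x y => ?_⟩
  · exact measurable_pi_lambda _ fun k => (measurable_snowflake p q _).comp (measurable_pi_apply _)
  set G : ℕ × ℤ × Bool → ℝ :=
    fun i => |snowflake p q (x i.1) i.2 - snowflake p q (y i.1) i.2| ^ q with hG
  change (Summable fun k => |x k - y k| ^ p) ↔ Summable (G ∘ e)
  rw [e.summable_iff, summable_prod_of_nonneg fun i => by simp only [hG, Pi.zero_apply]; positivity]
  constructor
  · intro hs
    refine ⟨fun k => (h (x k) (y k)).1, ?_⟩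
    refine Summable.of_nonneg_of_le (fun k => tsum_nonneg fun i => ?_)
      (fun k => (h (x k) (y k)).2.2) (hs.mul_left C)
    exact Real.rpow_nonneg (abs_nonneg _) _
  · rintro ⟨-, hs⟩
    refine (summable_mul_left_iff hc.ne').1 ?_
    exact Summable.of_nonneg_of_le (fun k => by positivity) (fun k => (h (x k) (y k)).2.1) hs

open Filter Topology

/-! ### Irreducibility: no additive reduction -/

/-- The power mean inequality bounds the total by `m ^ (p - 1)` times the sum of the `m` step costs,
hence by `m ^ p` times the largest. -/
theorem exists_sum_abs_rpow_le_mul {p : ℝ} (hp : 1 ≤ p) (S : Finset ℕ) (G : ℕ → ℕ → ℝ) {m : ℕ}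
    (hm : 0 < m) : ∃ t < m, ∑ i ∈ S, |G 0 i - G m i| ^ p ≤
      (m : ℝ) ^ p * ∑ i ∈ S, |G t i - G (t + 1) i| ^ p := by
  have hm' : (0 : ℝ) < m := by exact_mod_cast hm
  have key : ∑ i ∈ S, |G 0 i - G m i| ^ p ≤
      (m : ℝ) ^ (p - 1) * ∑ t ∈ Finset.range m, ∑ i ∈ S, |G t i - G (t + 1) i| ^ p := by
    rw [Finset.sum_comm, Finset.mul_sum]
    refine Finset.sum_le_sum fun i _ => ?_
    have h := Real.rpow_sum_le_const_mul_sum_rpow (Finset.range m)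
      (fun t => G t i - G (t + 1) i) hp
    rw [Finset.card_range] at h
    refine le_trans (Real.rpow_le_rpow (abs_nonneg _) ?_ (by linarith)) h
    rw [← Finset.sum_range_sub' (fun t => G t i) m]
    exact Finset.abs_sum_le_sum_abs _ _
  obtain ⟨t, ht, hmax⟩ := Finset.exists_max_image (Finset.range m)
    (fun t => ∑ i ∈ S, |G t i - G (t + 1) i| ^ p) ⟨0, Finset.mem_range.2 hm⟩
  refine ⟨t, Finset.mem_range.1 ht, key.trans ?_⟩
  have hsum := Finset.sum_le_card_nsmul _ _ _ hmax
  rw [Finset.card_range, nsmul_eq_mul] at hsum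
  calc _ ≤ (m : ℝ) ^ (p - 1) * (m * ∑ i ∈ S, |G t i - G (t + 1) i| ^ p) := by gcongr
    _ = _ := by rw [← mul_assoc, ← Real.rpow_add_one hm'.ne', sub_add_cancel]

theorem exists_nat_two_pow_rpow_bounds {p : ℝ} (hp : 1 ≤ p) (j : ℕ) :
    ∃ r : ℕ, r ≤ j ∧ ((2 : ℝ) ^ r) ^ p ≤ j + 1 ∧ ((j : ℝ) + 1) ^ (1 / p) ≤ 2 * 2 ^ r := by
  have hp0 : 0 < p := by linarith
  have hj : (0 : ℝ) < j + 1 := by positivity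
  have hbase : (1 : ℝ) ≤ ((j : ℝ) + 1) ^ (1 / p) :=
    Real.one_le_rpow (by linarith [(Nat.cast_nonneg j : (0 : ℝ) ≤ j)]) (by positivity)
  obtain ⟨r, h₁, h₂⟩ := exists_nat_pow_near hbase (one_lt_two (α := ℝ))
  have h3 : ((2 : ℝ) ^ r) ^ p ≤ j + 1 := by
    calc ((2 : ℝ) ^ r) ^ p ≤ (((j : ℝ) + 1) ^ (1 / p)) ^ p :=
          Real.rpow_le_rpow (by positivity) h₁ hp0.le
      _ = j + 1 := by rw [← Real.rpow_mul hj.le, one_div_mul_cancel hp0.ne', Real.rpow_one]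
  refine ⟨r, ?_, h3, by rw [pow_succ'] at h₂; exact h₂.le⟩
  have h4 : (2 : ℝ) ^ r ≤ j + 1 := le_trans
    (Real.self_le_rpow_of_one_le (one_le_pow₀ (by norm_num)) hp) h3
  have h5 : (2 : ℕ) ^ r ≤ 2 ^ j := by
    have : (2 : ℕ) ^ r ≤ j + 1 := by exact_mod_cast h4
    exact this.trans j.lt_two_pow_self
  exact (Nat.pow_le_pow_iff_right (by norm_num)).1 h5

/-- There is no coordinatewise reduction of `ℓ^q`, restricted to a product of the grids
`{0, 2⁻ⁿ, …, 1}`, to `ℓ^p` when `p < q`. -/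
theorem not_forall_summable_iff_summable_block {p q : ℝ} (hp : 1 ≤ p) (hpq : p < q) (n : ℕ → ℕ)
    (hn : ∀ j, j ≤ n j) (S : ℕ → Finset ℕ) (G : ℕ → ℤ → ℕ → ℝ) :
    ¬ ∀ a b : ℕ → ℤ, (∀ j, 0 ≤ a j ∧ a j ≤ 2 ^ n j) → (∀ j, 0 ≤ b j ∧ b j ≤ 2 ^ n j) →
      ((Summable fun j => (|(a j : ℝ) - b j| / 2 ^ n j) ^ q) ↔
        Summable fun j => ∑ i ∈ S j, |G j (a j) i - G j (b j) i| ^ p) := by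
  intro H
  have hp0 : 0 < p := by linarith
  have hq0 : 0 < q := by linarith
  -- Otherwise infinitely many coordinates could jump from 0 to 1 at summable total cost, although
  -- the jumps are not `q`-summable.
  obtain ⟨c, hc, hev⟩ : ∃ c : ℝ, 0 < c ∧
      ∀ᶠ j in atTop, c ≤ ∑ i ∈ S j, |G j 0 i - G j (2 ^ n j) i| ^ p := by
    by_contra! hcon
    have hfr : ∀ m : ℕ, ∃ᶠ j in atTop,
        ∑ i ∈ S j, |G j 0 i - G j (2 ^ n j) i| ^ p < (1 / 2 : ℝ) ^ m := fun m => by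
      have := hcon ((1 / 2 : ℝ) ^ m) (by positivity)
      simpa using this
    obtain ⟨φ, hφ, hlt⟩ := extraction_forall_of_frequently hfr
    classical
    set b : ℕ → ℤ := fun j => if j ∈ Set.range φ then 2 ^ n j else 0 with hb
    have hbφ : ∀ m, b (φ m) = 2 ^ n (φ m) := fun m => if_pos ⟨m, rfl⟩
    have h := (H (fun _ => 0) b (fun j => ⟨le_rfl, by positivity⟩) fun j => by
      by_cases hj : j ∈ Set.range φ
      · simp only [hb, if_pos hj]; exact ⟨by positivity, le_rfl⟩
      · simp only [hb, if_neg hj]; exact ⟨le_rfl, by positivity⟩).2 (by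
      refine (hφ.injective.summable_iff fun j hj => ?_).1 ?_
      · have hbj : b j = 0 := if_neg hj
        simp [hbj, Real.zero_rpow hp0.ne']
      · refine Summable.of_nonneg_of_le (fun m => ?_) (fun m => ?_) summable_geometric_two
        · exact Finset.sum_nonneg fun i _ => by positivity
        · simp only [Function.comp_apply, hbφ]
          exact (hlt m).le)
    have h' := h.comp_injective hφ.injective
    have h1 : ((fun j => (|((0 : ℤ) : ℝ) - b j| / 2 ^ n j) ^ q) ∘ φ) = fun _ => (1 : ℝ) := by
      funext m
      simp only [Function.comp_apply, hbφ]
      push_cast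
      rw [zero_sub, abs_neg, abs_of_pos (by positivity), div_self (by positivity), Real.one_rpow]
    rw [h1, summable_const_iff] at h'
    exact one_ne_zero h'
  -- The grid is cut into `2 ^ r j` equal steps, a number of order `(j + 1) ^ (1 / p)`; `r j ≤ j ≤ n
  -- j` keeps the cut points on the grid.
  choose r hrj hr₁ hr₂ using exists_nat_two_pow_rpow_bounds hp
  have ht : ∀ j, ∃ t : ℕ, t < 2 ^ r j ∧ ∑ i ∈ S j, |G j 0 i - G j (2 ^ n j) i| ^ p ≤
      ((2 : ℝ) ^ r j) ^ p * ∑ i ∈ S j, |G j ((t : ℤ) * 2 ^ (n j - r j)) i -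
        G j (((t + 1 : ℕ) : ℤ) * 2 ^ (n j - r j)) i| ^ p := fun j => by
    obtain ⟨t, htm, h⟩ := exists_sum_abs_rpow_le_mul hp (S j)
      (fun t => G j ((t : ℤ) * 2 ^ (n j - r j))) (m := 2 ^ r j) (by positivity)
    refine ⟨t, htm, ?_⟩
    have e : ((2 ^ r j : ℕ) : ℤ) * 2 ^ (n j - r j) = 2 ^ n j := by
      push_cast
      rw [← pow_add, Nat.add_sub_cancel' ((hrj j).trans (hn j))]
    simp only [e] at h
    simpa using h
  choose t htm ht using ht
  have hbd : ∀ j (s : ℕ), s ≤ 2 ^ r j →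
      0 ≤ (s : ℤ) * 2 ^ (n j - r j) ∧ (s : ℤ) * 2 ^ (n j - r j) ≤ 2 ^ n j := fun j s hs => by
    refine ⟨by positivity, ?_⟩
    have e : (2 : ℤ) ^ r j * 2 ^ (n j - r j) = 2 ^ n j := by
      rw [← pow_add, Nat.add_sub_cancel' ((hrj j).trans (hn j))]
    rw [← e]
    have : (s : ℤ) ≤ 2 ^ r j := by exact_mod_cast hs
    gcongr
  have hsum := (H (fun j => (t j : ℤ) * 2 ^ (n j - r j))
    (fun j => ((t j + 1 : ℕ) : ℤ) * 2 ^ (n j - r j)) (fun j => hbd j _ (htm j).le)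
    (fun j => hbd j _ (htm j))).1 (by
      have hs : Summable fun j : ℕ => 2 ^ q * (1 / |(j : ℝ) + 1| ^ (q / p)) :=
        ((Real.summable_one_div_nat_add_rpow 1 (q / p)).2 (by rwa [one_lt_div hp0])).mul_left _
      refine Summable.of_nonneg_of_le (fun j => by positivity) (fun j => ?_) hs
      have e : |(((t j : ℤ) * 2 ^ (n j - r j) : ℤ) : ℝ) -
          ((((t j + 1 : ℕ) : ℤ) * 2 ^ (n j - r j) : ℤ) : ℝ)| / 2 ^ n j = ((2 : ℝ) ^ r j)⁻¹ := by
        push_cast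
        rw [← sub_mul, sub_add_cancel_left, neg_one_mul, abs_neg, abs_of_pos (by positivity),
          div_eq_iff (by positivity), eq_inv_mul_iff_mul_eq₀ (by positivity), ← pow_add,
          Nat.add_sub_cancel' ((hrj j).trans (hn j))]
      have hj : (0 : ℝ) < j + 1 := by positivity
      rw [e, abs_of_pos hj]
      have h1 : ((2 : ℝ) ^ r j)⁻¹ ≤ 2 / ((j : ℝ) + 1) ^ (1 / p) := by
        rw [inv_eq_one_div, div_le_div_iff₀ (by positivity) (by positivity), one_mul]
        exact hr₂ j
      refine (Real.rpow_le_rpow (by positivity) h1 hq0.le).trans_eq ?_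
      rw [Real.div_rpow (by norm_num) (by positivity), ← Real.rpow_mul hj.le, ← mul_one_div,
        one_div_mul_eq_div])
  have hharm : Summable fun j : ℕ => c * (1 / ((j : ℝ) + 1)) := by
    refine Summable.of_norm_bounded_eventually_nat hsum ?_
    filter_upwards [hev] with j hj
    rw [Real.norm_of_nonneg (by positivity), mul_one_div, div_le_iff₀ (by positivity), mul_comm]
    refine (hj.trans (ht j)).trans ?_
    exact mul_le_mul_of_nonneg_right (hr₁ j) (Finset.sum_nonneg fun i _ => by positivity)
  have h2 : Summable fun j : ℕ => 1 / (((j + 1 : ℕ) : ℝ)) := by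
    simpa using (summable_mul_left_iff hc.ne').1 hharm
  exact Real.not_summable_one_div_natCast ((summable_nat_add_iff 1).1 h2)

/-! ### Irreducibility: generic continuity -/

/-- Borel sets have the Baire property: on a suitable dense `Gδ` set, every `B i` agrees with an
open set. -/
theorem exists_dense_isOpen_forall_eventually_mem {X ι : Type*} [TopologicalSpace X] [BaireSpace X]
    [MeasurableSpace X] [BorelSpace X] [Countable ι] (B : ι → Set X)
    (hB : ∀ i, MeasurableSet (B i)) :
    ∃ D : ℕ → Set X, (∀ m, IsOpen (D m)) ∧ (∀ m, Dense (D m)) ∧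
      ∀ i, ∀ x ∈ ⋂ m, D m, x ∈ B i → ∀ᶠ y in 𝓝 x, y ∈ ⋂ m, D m → y ∈ B i := by
  choose U hU hBU using fun i => (hB i).residualEq_isOpen
  have hres : ∀ᶠ x in residual X, ∀ i, x ∈ B i ↔ x ∈ U i :=
    eventually_countable_forall.2 fun i => (hBU i).mem_iff
  obtain ⟨t, ht, htd, h⟩ := eventually_residual.1 hres
  obtain ⟨D, hDo, rfl⟩ := isGδ_iff_eq_iInter_nat.1 ht
  refine ⟨D, hDo, fun m => htd.mono (Set.iInter_subset _ m), fun i x hx hxB => ?_⟩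
  filter_upwards [(hU i).mem_nhds ((h x hx i).1 hxB)] with y hy hyD
  exact (h y hyD i).2 hy

theorem eventually_forall_prefix_of_eventually_nhds {x : ℕ → ℤ} {P : (ℕ → ℤ) → Prop}
    (h : ∀ᶠ y in 𝓝 x, P y) : ∀ᶠ N in atTop, ∀ y : ℕ → ℤ, (∀ i < N, y i = x i) → P y := by
  rw [Filter.Eventually, nhds_pi, Filter.mem_pi'] at h
  obtain ⟨I, t, ht, hI⟩ := h
  filter_upwards [eventually_ge_atTop (I.sup id + 1)] with N hN y hy
  refine hI fun i hi => ?_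
  have hi' : i ≤ I.sup id := Finset.le_sup (f := id) hi
  rw [hy i (by omega)]
  exact mem_of_mem_nhds (ht i)

/-- The integer sequences supported on `{0, …, m}` whose `i`-th term lies in `{0, …, 2 ^ i}`. -/
def boxSet (m : ℕ) : Set (ℕ → ℤ) :=
  {u | (∀ i, 0 ≤ u i ∧ u i ≤ 2 ^ i) ∧ ∀ i, m < i → u i = 0}

theorem finite_boxSet (m : ℕ) : (boxSet m).Finite := by
  refine Set.Finite.of_injOn (f := fun u (i : Fin (m + 1)) => u i)
    (t := Set.pi Set.univ fun i : Fin (m + 1) => Set.Icc (0 : ℤ) (2 ^ (i : ℕ))) ?_ ?_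
    (Set.Finite.pi fun i => Set.finite_Icc _ _)
  · exact fun u hu i _ => hu.1 i
  · intro u hu v hv huv
    funext i
    rcases le_or_gt i m with hi | hi
    · exact congrFun huv ⟨i, Nat.lt_succ_of_le hi⟩
    · rw [hu.2 i hi, hv.2 i hi]

theorem countable_iUnion_boxSet : (⋃ m, boxSet m).Countable :=
  Set.countable_iUnion fun m => (finite_boxSet m).countable

theorem exists_forall_sum_Ico_le {f : ℕ → ℝ} (hf : Summable f) (h0 : ∀ i, 0 ≤ f i) {ε : ℝ}
    (hε : 0 < ε) : ∃ K, ∀ L, ∑ i ∈ Finset.Ico K L, f i ≤ ε := by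
  obtain ⟨K, hK⟩ := ((tendsto_order.1 (tendsto_sum_nat_add f)).2 ε hε).exists
  refine ⟨K, fun L => le_trans ?_ hK.le⟩
  rw [Finset.sum_Ico_eq_sum_range]
  have := ((summable_nat_add_iff K).2 hf).sum_le_tsum (Finset.range (L - K)) fun i _ => h0 _
  simpa only [add_comm] using this

/-- Around a generic point `z`, a map that sends eventually equal sequences to `ℓ^p`-equivalent
ones is uniformly under control on the translates of `z` by box sequences. -/
theorem exists_generic_point {p : ℝ} {g : (ℕ → ℤ) → ℕ → ℝ}
    (hg : ∀ i, Measurable fun x => g x i) {Q : Set ℝ} (hQ : Q.Countable) (hgQ : ∀ x i, g x i ∈ Q)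
    (hfin : ∀ m, ∀ u ∈ boxSet m, ∀ x, Summable fun i => |g x i - g (x - u) i| ^ p) :
    ∃ (z : ℕ → ℤ) (D : ℕ → Set (ℕ → ℤ)) (F : ℕ → ℕ), (∀ m, m < F m) ∧
      ∀ m, ∀ u ∈ boxSet m, ∀ y : ℕ → ℤ, (∀ i < F m, y i = z i + u i) →
        (∀ l ≤ m, y ∈ D l) ∧ (y ∈ ⋂ l, D l → (∀ i < m, g y i = g (z + u) i) ∧
          ∀ L, ∑ i ∈ Finset.Ico (F m) L, |g y i - g (y - u) i| ^ p ≤ (1 / 2) ^ m) := by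
  have := hQ.to_subtype
  have := countable_iUnion_boxSet.to_subtype
  -- Countably many Borel sets: the level sets of the coordinates of `g`, and the sets where a box
  -- translation has a uniformly small tail cost.
  let B : (ℕ × Q) ⊕ ((⋃ m, boxSet m) × ℕ × ℕ) → Set (ℕ → ℤ) := Sum.elim
    (fun a => {x | g x a.1 = a.2})
    (fun a => {x | ∀ L, ∑ i ∈ Finset.Ico a.2.2 L, |g x i - g (x - a.1) i| ^ p ≤ (1 / 2) ^ a.2.1})
  have hB : ∀ i, MeasurableSet (B i) := by
    rintro (⟨i, c⟩ | ⟨u, m, K⟩)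
    · exact measurableSet_eq_fun (hg i) measurable_const
    · have : B (Sum.inr (u, m, K)) = ⋂ L, {x | ∑ i ∈ Finset.Ico K L,
          |g x i - g (x - u) i| ^ p ≤ (1 / 2) ^ m} := by ext x; simp [B]
      rw [this]
      refine MeasurableSet.iInter fun L => measurableSet_le ?_ measurable_const
      have htr : Measurable fun x : ℕ → ℤ => x - (u : ℕ → ℤ) := measurable_id.sub_const _
      refine Finset.measurable_sum _ fun i _ => ?_
      exact ((hg i).sub ((hg i).comp htr)).abs.pow_const p
  obtain ⟨D, hDo, hDd, hD⟩ := exists_dense_isOpen_forall_eventually_mem B hB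
  obtain ⟨z, hz⟩ : ∃ z : ℕ → ℤ, ∀ u ∈ ⋃ m, boxSet m, z + u ∈ ⋂ l, D l := by
    have hres : ∀ᶠ z in residual (ℕ → ℤ), ∀ u : ↥(⋃ m, boxSet m), z + (u : ℕ → ℤ) ∈ ⋂ l, D l := by
      refine eventually_countable_forall.2 fun u => ?_
      have hmem : (⋂ l, D l) ∈ residual (ℕ → ℤ) :=
        countable_iInter_mem.2 fun l => residual_of_dense_open (hDo l) (hDd l)
      exact tendsto_residual_of_isOpenMap (Homeomorph.addRight (u : ℕ → ℤ)).continuous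
        (Homeomorph.addRight (u : ℕ → ℤ)).isOpenMap hmem
    obtain ⟨z, hz⟩ := (dense_of_mem_residual hres).nonempty
    exact ⟨z, fun u hu => hz ⟨u, hu⟩⟩
  refine ⟨z, D, ?_⟩
  suffices h : ∀ m, ∃ N, m < N ∧ ∀ u ∈ boxSet m, ∀ y : ℕ → ℤ, (∀ i < N, y i = z i + u i) →
      (∀ l ≤ m, y ∈ D l) ∧ (y ∈ ⋂ l, D l → (∀ i < m, g y i = g (z + u) i) ∧
        ∀ L, ∑ i ∈ Finset.Ico N L, |g y i - g (y - u) i| ^ p ≤ (1 / 2) ^ m) by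
    choose F hF using h
    exact ⟨F, fun m => (hF m).1, fun m => (hF m).2⟩
  intro m
  suffices h : ∀ u ∈ boxSet m, ∀ᶠ N in atTop, ∀ y : ℕ → ℤ, (∀ i < N, y i = z i + u i) →
      (∀ l ≤ m, y ∈ D l) ∧ (y ∈ ⋂ l, D l → (∀ i < m, g y i = g (z + u) i) ∧
        ∀ L, ∑ i ∈ Finset.Ico N L, |g y i - g (y - u) i| ^ p ≤ (1 / 2) ^ m) by
    exact ((eventually_gt_atTop m).and ((finite_boxSet m).eventually_all.2 h)).exists
  intro u hu
  have hu' : u ∈ ⋃ m, boxSet m := Set.mem_iUnion.2 ⟨m, hu⟩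
  have hzu := hz u hu'
  obtain ⟨K, hK⟩ := exists_forall_sum_Ico_le (hfin m u hu (z + u)) (fun i => by positivity)
    (ε := (1 / 2) ^ m) (by positivity)
  have h₁ : ∀ᶠ y in 𝓝 (z + u), ∀ l ∈ Finset.range (m + 1), y ∈ D l :=
    (Finset.eventually_all _).2 fun l _ => (hDo l).mem_nhds (Set.mem_iInter.1 hzu l)
  have h₂ : ∀ᶠ y in 𝓝 (z + u), ∀ i ∈ Finset.range m, y ∈ ⋂ l, D l → g y i = g (z + u) i :=
    (Finset.eventually_all _).2 fun i _ => hD (Sum.inl (i, ⟨g (z + u) i, hgQ _ _⟩)) _ hzu rfl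
  have h₃ := hD (Sum.inr (⟨u, hu'⟩, m, K)) _ hzu hK
  filter_upwards [eventually_forall_prefix_of_eventually_nhds (h₁.and (h₂.and h₃)),
    eventually_ge_atTop K] with N hN hKN y hy
  obtain ⟨hy₁, hy₂, hy₃⟩ := hN y hy
  refine ⟨fun l hl => hy₁ l (Finset.mem_range_succ_iff.2 hl), fun hyD => ⟨fun i hi => hy₂ i (Finset.mem_range.2 hi) hyD, fun L => ?_⟩⟩
  refine le_trans (Finset.sum_le_sum_of_subset_of_nonneg
    (Finset.Ico_subset_Ico_left hKN) fun i _ _ => by positivity) (hy₃ hyD L)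

/-- A map as in `exists_generic_point` depends, on a suitable set of sequences, on each coordinate
only through its own block of values, up to a summable error. -/
theorem exists_block_decomposition {p : ℝ} (hp : 0 < p) {g : (ℕ → ℤ) → ℕ → ℝ}
    (hg : ∀ i, Measurable fun x => g x i) {Q : Set ℝ} (hQ : Q.Countable) (hgQ : ∀ x i, g x i ∈ Q)
    (hfin : ∀ m, ∀ u ∈ boxSet m, ∀ x, Summable fun i => |g x i - g (x - u) i| ^ p) :
    ∃ (z : ℕ → ℤ) (n k : ℕ → ℕ), StrictMono n ∧ StrictMono k ∧ k 0 = 0 ∧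
      ∀ u : ℕ → ℤ, (∀ i, 0 ≤ u i ∧ u i ≤ 2 ^ i) → (∀ i ∉ Set.range n, u i = 0) → ∀ j,
        ∑ i ∈ Finset.Ico (k j) (k (j + 1)),
          |g (z + u) i - g (z + Pi.single (n j) (u (n j))) i| ^ p ≤ 2 * (1 / 2) ^ j := by
  classical
  obtain ⟨z, D, F, hF, H⟩ := exists_generic_point hg hQ hgQ hfin
  -- The inner `F` gives `k (j + 1)`, past which changing coordinates up to `n j` costs little. The
  -- outer `F` gives `n (j + 1)`, a prefix length that fixes the output below `k (j + 1)`.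
  let n : ℕ → ℕ := fun j => (fun m => F (F m))^[j] 0
  have hn_succ : ∀ j, n (j + 1) = F (F (n j)) := fun j => Function.iterate_succ_apply' _ _ _
  let k : ℕ → ℕ := fun j => Nat.casesOn j 0 fun i => F (n i)
  have hk_succ : ∀ j, k (j + 1) = F (n j) := fun j => rfl
  have hnk : ∀ j, n j < k (j + 1) := fun j => hF _
  have hkn : ∀ j, k (j + 1) < n (j + 1) := fun j => by rw [hn_succ]; exact hF _
  have hn : StrictMono n := strictMono_nat_of_lt_succ fun j => (hnk j).trans (hkn j)
  have hk : StrictMono k := strictMono_nat_of_lt_succ fun j => by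
    cases j with
    | zero => exact (Nat.zero_le _).trans_lt (hF _)
    | succ j => exact (hkn j).trans (hnk _)
  have hgap : ∀ {i j}, n j < i → i < n (j + 1) → i ∉ Set.range n := by
    rintro i j h₁ h₂ ⟨l, rfl⟩
    have := hn.lt_iff_lt.1 h₁
    have := hn.lt_iff_lt.1 h₂
    omega
  -- the truncation of `u` to the coordinates up to `m`
  let tr : ℕ → (ℕ → ℤ) → ℕ → ℤ := fun m u i => if i ≤ m then u i else 0
  have htr : ∀ m u, (∀ i, 0 ≤ u i ∧ u i ≤ 2 ^ i) → tr m u ∈ boxSet m := fun m u hu => by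
    refine ⟨fun i => ?_, fun i hi => if_neg (not_le.2 hi)⟩
    by_cases hi : i ≤ m
    · simpa [tr, hi] using hu i
    · simp [tr, hi]
  have hpre : ∀ j u, (∀ i ∉ Set.range n, u i = 0) → ∀ i < n (j + 1),
      (z + u) i = z i + tr (n j) u i := fun j u hu i hi => by
    by_cases hij : i ≤ n j
    · simp [tr, hij]
    · simp [tr, hij, hu i (hgap (not_le.1 hij) hi)]
  have hmem : ∀ u, (∀ i, 0 ≤ u i ∧ u i ≤ 2 ^ i) → (∀ i ∉ Set.range n, u i = 0) →
      z + u ∈ ⋂ l, D l := fun u hu hu0 => by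
    refine Set.mem_iInter.2 fun l => ?_
    exact (H (n l) (tr (n l) u) (htr _ u hu) (z + u)
      fun i hi => hpre l u hu0 i (hi.trans (hkn l))).1 l (hn.id_le l)
  have hdec : ∀ j u, (∀ i, 0 ≤ u i ∧ u i ≤ 2 ^ i) → (∀ i ∉ Set.range n, u i = 0) →
      (∀ i < n j, u i = 0) → ∀ i < k (j + 1),
        g (z + u) i = g (z + Pi.single (n j) (u (n j))) i := fun j u hu hu0 huj => by
    refine ((H (k (j + 1)) (Pi.single (n j) (u (n j))) ⟨fun i => ?_, fun i hi => ?_⟩ (z + u)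
      fun i hi => ?_).2 (hmem u hu hu0)).1
    · rcases eq_or_ne i (n j) with rfl | hi
      · simpa using hu (n j)
      · simp [hi]
    · exact Pi.single_eq_of_ne ((hnk j).trans hi).ne' _
    · rw [hk_succ, ← hn_succ] at hi
      rcases lt_trichotomy i (n j) with h | rfl | h
      · simp [huj i h, h.ne]
      · simp
      · simp [hu0 i (hgap h hi), h.ne']
  refine ⟨z, n, k, hn, hk, rfl, fun u hu hu0 j => ?_⟩
  cases j with
  | zero =>
    rw [Finset.sum_eq_zero fun i hi => ?_]
    · positivity
    · rw [hdec 0 u hu hu0 (fun i hi => absurd hi (Nat.not_lt_zero i)) i (Finset.mem_Ico.1 hi).2,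
        sub_self, abs_zero, Real.zero_rpow hp.ne']
  | succ j =>
    -- Erasing the coordinates up to `n j` costs at most `(1 / 2) ^ n j` beyond `k (j + 1)`;
    -- afterwards `hdec` gives exact dependence on the coordinate `n (j + 1)` alone.
    set u' : ℕ → ℤ := u - tr (n j) u with hu'
    have hu'_le : ∀ {i}, i ≤ n j → u' i = 0 := fun {i} hi => by simp [hu', tr, hi]
    have hu'_gt : ∀ {i}, n j < i → u' i = u i := fun {i} hi => by simp [hu', tr, not_le.2 hi]
    have hu'0 : ∀ i ∉ Set.range n, u' i = 0 := fun i hi => by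
      rcases le_or_gt i (n j) with h | h
      · exact hu'_le h
      · rw [hu'_gt h, hu0 i hi]
    have hdec' := hdec (j + 1) u' (fun i => by
      rcases le_or_gt i (n j) with h | h
      · rw [hu'_le h]; exact ⟨le_rfl, by positivity⟩
      · rw [hu'_gt h]; exact hu i) hu'0 (fun i hi => by
      rcases le_or_gt i (n j) with h | h
      · exact hu'_le h
      · exact hu'0 i (hgap h hi))
    rw [hu'_gt (hn j.lt_succ_self), hu', ← add_sub_assoc] at hdec'
    have hb := ((H (n j) (tr (n j) u) (htr _ u hu) (z + u)
      fun i hi => hpre j u hu0 i (hi.trans (hkn j))).2 (hmem u hu hu0)).2 (k (j + 1 + 1))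
    rw [Finset.sum_congr rfl fun i hi => by rw [← hdec' i (Finset.mem_Ico.1 hi).2]]
    refine hb.trans ?_
    rw [pow_succ, mul_left_comm, mul_one_div_cancel two_ne_zero, mul_one]
    exact pow_le_pow_of_le_one (by norm_num) (by norm_num) (hn.id_le j)

/-! ### Irreducibility: conclusion -/

theorem summable_iff_summable_sum_Ico {f : ℕ → ℝ} (hf : ∀ i, 0 ≤ f i) {k : ℕ → ℕ}
    (hk : StrictMono k) (hk0 : k 0 = 0) :
    Summable f ↔ Summable fun j => ∑ i ∈ Finset.Ico (k j) (k (j + 1)), f i := by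
  have hsum : ∀ J, ∑ j ∈ Finset.range J, ∑ i ∈ Finset.Ico (k j) (k (j + 1)), f i =
      ∑ i ∈ Finset.range (k J), f i := fun J => by
    induction J with
    | zero => simp [hk0]
    | succ J ih =>
      rw [Finset.sum_range_succ, ih, Finset.sum_range_add_sum_Ico _ (hk J.lt_succ_self).le]
  constructor
  · intro h
    refine summable_of_sum_range_le (c := ∑' i, f i)
      (fun j => Finset.sum_nonneg fun i _ => hf i) fun J => ?_
    rw [hsum]
    exact h.sum_le_tsum _ fun i _ => hf i
  · intro h
    refine summable_of_sum_range_le hf fun N =>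
      le_trans ?_ (h.sum_le_tsum (Finset.range N) fun j _ => Finset.sum_nonneg fun i _ => hf i)
    rw [hsum]
    exact Finset.sum_le_sum_of_subset_of_nonneg
      (Finset.range_subset_range.2 (hk.id_le N)) fun i _ _ => hf i

theorem sum_abs_sub_rpow_le {p : ℝ} (hp : 1 ≤ p) (S : Finset ℕ) (a b c d : ℕ → ℝ) :
    ∑ i ∈ S, |a i - d i| ^ p ≤ 3 ^ (p - 1) * (∑ i ∈ S, |a i - b i| ^ p +
      ∑ i ∈ S, |b i - c i| ^ p + ∑ i ∈ S, |c i - d i| ^ p) := by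
  rw [← Finset.sum_add_distrib, ← Finset.sum_add_distrib, Finset.mul_sum]
  refine Finset.sum_le_sum fun i _ => ?_
  have h := Real.rpow_sum_le_const_mul_sum_rpow (Finset.univ : Finset (Fin 3))
    ![a i - b i, b i - c i, c i - d i] hp
  simp only [Fin.sum_univ_three, Finset.card_univ, Fintype.card_fin, Matrix.cons_val] at h
  refine le_trans (Real.rpow_le_rpow (abs_nonneg _) ?_ (by linarith)) (by exact_mod_cast h)
  linarith [abs_sub_le (a i) (b i) (d i), abs_sub_le (b i) (c i) (d i)]

theorem summable_block_iff {p : ℝ} (hp : 1 ≤ p) {x x' : ℕ → ℝ} {y y' : ℕ → ℕ → ℝ} {k : ℕ → ℕ}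
    (hk : StrictMono k) (hk0 : k 0 = 0)
    (hx : Summable fun j => ∑ i ∈ Finset.Ico (k j) (k (j + 1)), |x i - y j i| ^ p)
    (hx' : Summable fun j => ∑ i ∈ Finset.Ico (k j) (k (j + 1)), |x' i - y' j i| ^ p) :
    (Summable fun i => |x i - x' i| ^ p) ↔
      Summable fun j => ∑ i ∈ Finset.Ico (k j) (k (j + 1)), |y j i - y' j i| ^ p := by
  rw [summable_iff_summable_sum_Ico (fun i => by positivity) hk hk0]
  constructor <;> intro h
  · refine Summable.of_nonneg_of_le (fun j => Finset.sum_nonneg fun i _ => by positivity)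
      (fun j => sum_abs_sub_rpow_le hp _ (y j) x x' (y' j)) (((Summable.add ?_ h).add hx').mul_left _)
    simpa only [abs_sub_comm] using hx
  · refine Summable.of_nonneg_of_le (fun j => Finset.sum_nonneg fun i _ => by positivity)
      (fun j => sum_abs_sub_rpow_le hp _ x (y j) (y' j) x') ((hx.add h |>.add ?_).mul_left _)
    simpa only [abs_sub_comm] using hx'

/-- Rounding stays within the `ℓ^p` class and leaves countably many values, so a generic map becomes
locally constant in each coordinate. -/
theorem summable_abs_sub_floor_rpow {p : ℝ} (hp : 1 ≤ p) (x : ℕ → ℝ) :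
    Summable fun i => |x i - ⌊x i * 2 ^ i⌋ / 2 ^ i| ^ p := by
  refine Summable.of_nonneg_of_le (fun i => by positivity) (fun i => ?_) summable_geometric_two
  have h2 : (0 : ℝ) < 2 ^ i := by positivity
  have e : x i - ⌊x i * 2 ^ i⌋ / 2 ^ i = Int.fract (x i * 2 ^ i) / 2 ^ i := by
    rw [Int.fract]; field_simp
  have h1 : |x i - ⌊x i * 2 ^ i⌋ / 2 ^ i| ≤ (1 / 2) ^ i := by
    rw [e, abs_of_nonneg (div_nonneg (Int.fract_nonneg _) h2.le), one_div, inv_pow, ← one_div]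
    gcongr
    exact (Int.fract_lt_one _).le
  refine le_trans ?_ h1
  exact Real.rpow_le_self_of_le_one (abs_nonneg _)
    (h1.trans (pow_le_one₀ (by norm_num) (by norm_num))) hp

theorem not_borelReducible_ellSetoid {p q : ℝ} (hp : 1 ≤ p) (hpq : p < q) :
    ¬ BorelReducible (ellSetoid q (hp.trans hpq.le)) (ellSetoid p hp) := by
  rintro ⟨θ, hθ, hred⟩
  have hp0 : 0 < p := by linarith
  have hq0 : 0 < q := by linarith
  let code : (ℕ → ℤ) → ℕ → ℝ := fun x i => x i / 2 ^ i
  let g : (ℕ → ℤ) → ℕ → ℝ := fun x i => ⌊θ (code x) i * 2 ^ i⌋ / 2 ^ i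
  have hcode : Measurable code := measurable_pi_lambda _ fun i =>
    ((measurable_of_countable (fun a : ℤ => (a : ℝ))).comp (measurable_pi_apply i)).div_const _
  have hg : ∀ i, Measurable fun x => g x i := fun i =>
    ((measurable_of_countable (fun a : ℤ => (a : ℝ))).comp (Int.measurable_floor.comp
      (((measurable_pi_apply i).comp (hθ.comp hcode)).mul_const _))).div_const _
  have hgred : ∀ x y, (Summable fun i => |g x i - g y i| ^ p) ↔
      Summable fun i => |code x i - code y i| ^ q := fun x y => by
    have h : ∀ x, ellSetoid p hp (θ (code x)) (g x) :=
      fun x => summable_abs_sub_floor_rpow hp (θ (code x))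
    refine Iff.trans ?_ (hred (code x) (code y)).symm
    exact ⟨fun hs => (ellSetoid p hp).trans ((ellSetoid p hp).trans (h x) hs)
        ((ellSetoid p hp).symm (h y)),
      fun hs => (ellSetoid p hp).trans ((ellSetoid p hp).trans ((ellSetoid p hp).symm (h x)) hs)
        (h y)⟩
  have hfin : ∀ m, ∀ u ∈ boxSet m, ∀ x, Summable fun i => |g x i - g (x - u) i| ^ p := by
    intro m u hu x
    refine (hgred _ _).2 (summable_of_ne_finset_zero (s := Finset.range (m + 1)) fun i hi => ?_)
    have hi' : u i = 0 := hu.2 i (by simpa using hi)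
    simp [code, hi', Real.zero_rpow hq0.ne']
  obtain ⟨z, n, k, hn, hk, hk0, H⟩ := exists_block_decomposition hp0 hg
    (Q := Set.range fun a : ℤ × ℕ => (a.1 : ℝ) / 2 ^ a.2) (Set.countable_range _)
    (fun x i => ⟨(⌊θ (code x) i * 2 ^ i⌋, i), rfl⟩) hfin
  refine not_forall_summable_iff_summable_block hp hpq n hn.id_le
    (fun j => Finset.Ico (k j) (k (j + 1))) (fun j a => g (z + Pi.single (n j) a))
    fun a b ha hb => ?_
  -- `Function.extend n a 0` places `a j` at position `n j` and zeros elsewhere.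
  have hzero : ∀ (a : ℕ → ℤ), ∀ i ∉ Set.range n, Function.extend n a 0 i = 0 :=
    fun a i hi => Function.extend_apply' a _ i hi
  have hext : ∀ a : ℕ → ℤ, (∀ j, 0 ≤ a j ∧ a j ≤ 2 ^ n j) →
      Summable fun j => ∑ i ∈ Finset.Ico (k j) (k (j + 1)),
        |g (z + Function.extend n a 0) i - g (z + Pi.single (n j) (a j)) i| ^ p := fun a ha => by
    refine Summable.of_nonneg_of_le (fun j => Finset.sum_nonneg fun i _ => by positivity)
      (fun j => ?_) (summable_geometric_two.mul_left 2)
    have h := H (Function.extend n a 0) (fun i => ?_)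
      (hzero a) j
    · rwa [hn.injective.extend_apply] at h
    · by_cases hi : i ∈ Set.range n
      · obtain ⟨j, rfl⟩ := hi
        rw [hn.injective.extend_apply]
        exact ha j
      · rw [hzero a i hi]
        exact ⟨le_rfl, by positivity⟩
  rw [← summable_block_iff hp hk hk0 (hext a ha) (hext b hb), hgred]
  refine Iff.trans (summable_congr fun j => ?_) (hn.injective.summable_iff
    (f := fun i => |code (z + Function.extend n a 0) i - code (z + Function.extend n b 0) i| ^ q)
    fun i hi => ?_)
  · simp only [Function.comp_apply, code, Pi.add_apply, hn.injective.extend_apply]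
    rw [← sub_div, abs_div, abs_of_pos (by positivity : (0 : ℝ) < 2 ^ n j)]
    push_cast
    rw [add_sub_add_left_eq_sub]
  · simp only [code, Pi.add_apply]
    rw [hzero a i hi, hzero b i hi, sub_self, abs_zero, Real.zero_rpow hq0.ne']

theorem mainTheorem11 (p q : ℝ) (hp : 1 ≤ p) (hpq : p < q) :
    StrictlyBorelReducible (ellSetoid p hp) (ellSetoid q (hp.trans hpq.le)) := by
  exact ⟨borelReducible_ellSetoid hp hpq, not_borelReducible_ellSetoid hp hpq⟩
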